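/- Let $f_1,\dots,f_k\in\mathbb{R}[x_1,\dots,x_n]$ have a nonempty common real zero set $V_{\mathbb R}(f)\subset\mathbb{R}^n$, let $\mathcal{J}$ be the $k\times n$ Jacobian matrix of $f=(f_1,\dots,f_k)^t$, and let $\beta>0$. Let $V_{\mathbb R}(h)\subset\mathbb{R}^{n+k}$ be the real zero set of $h=\{f_1+w_1/\sqrt\beta,\dots,f_k+w_k/\sqrt\beta\}$ in the variables $(x,w)=(x_1,\dots,x_n,w_1,\dots,w_k)$. Then $V_{\mathbb R}(h)$ is a smooth embedded submanifold of $\mathbb{R}^{n+k}$ of dimension $n$, and there is an open set $U'\subset\mathbb{R}^n$ containing $V_{\mathbb R}(f)$ such that: 1. For every $\mathfrak{a}\in U'$ there is a unique point $(x^*,w^*)\in V_{\mathbb R}(h)$ at minimal Euclidean distance from $(\mathfrak{a},0)\in\mathbb{R}^{n+k}$. 2. For every $\mathfrak{a}\in U'$, the component $x^*$ of this point is an isolated simple zero of the square system $x+\beta\,\mathcal{J}(x)^t f(x)=\mathfrak{a}$; that is, it is a solution, no other (even complex) solution lies in some neighbourhood of it, and the Jacobian matrix of the system is nonsingular at $x^*$.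 3. Let $1\le r\le\infty$ and let $\mathfrak{a}:[s,t]\to U'$ be a continuous, piecewise $C^r$ curve (for $r=\infty$: a piecewise smooth curve), and let $(x^*(u),w^*(u))$ be the nearest point on $V_{\mathbb R}(h)$ to $(\mathfrak{a}(u),0)$. Then $u\mapsto(x^*(u),w^*(u))$ is continuous and piecewise $C^r$, and it is obtained by solving the system continuously from any initial point of the curve: for every $u_0\in[s,t]$, $x^*$ is the only continuous $y:[s,t]\to\mathbb{R}^n$ with $y(u)+\beta\,\mathcal{J}(y(u))^t f(y(u))=\mathfrak{a}(u)$ for all $u\in[s,t]$ and $y(u_0)=x^*(u_0)$. -/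

import Mathlib

open scoped ContDiff

noncomputable section

namespace CompanionCurve

/-- The real zero set `V_ℝ(f)` of a family of real polynomials, in Euclidean space. -/
def realZeros {σ ι : Type*} (f : ι → MvPolynomial σ ℝ) : Set (EuclideanSpace ℝ σ) :=
  {x | ∀ i, MvPolynomial.eval (fun j => x j) (f i) = 0}

/-- The system `h = {f₁ + w₁/√β, …, f_k + w_k/√β}` in the variables `x₁, …, xₙ` (left summand)
and `w₁, …, w_k` (right summand). -/
def slackSystem {n k : ℕ} (f : Fin k → MvPolynomial (Fin n) ℝ) (β : ℝ) :
    Fin k → MvPolynomial (Fin n ⊕ Fin k) ℝ :=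
  fun i => MvPolynomial.rename Sum.inl (f i)
    + MvPolynomial.C (1 / √β) * MvPolynomial.X (Sum.inr i)

/-- The square polynomial system `x + β Jᵗ f - a`, where `J` is the Jacobian of `f`. -/
def penaltySystem {n k : ℕ} (f : Fin k → MvPolynomial (Fin n) ℝ) (β : ℝ)
    (a : EuclideanSpace ℝ (Fin n)) : Fin n → MvPolynomial (Fin n) ℝ :=
  fun j => MvPolynomial.X j
    + MvPolynomial.C β * ∑ i, MvPolynomial.pderiv j (f i) * f i
    - MvPolynomial.C (a j)

/-- The Jacobian matrix of a polynomial system at a real point. -/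
def jacobianAt {σ ι : Type*} (F : ι → MvPolynomial σ ℝ) (x : EuclideanSpace ℝ σ) :
    Matrix ι σ ℝ :=
  Matrix.of fun i j => MvPolynomial.eval (fun l => x l) (MvPolynomial.pderiv j (F i))

/-- `x` is an isolated simple zero of the square system `F`: it is a zero, no other complex
(in particular no other real) zero lies close to it, and the Jacobian of `F` is nonsingular
there. -/
structure IsIsolatedSimpleZero {n : ℕ} (F : Fin n → MvPolynomial (Fin n) ℝ)
    (x : EuclideanSpace ℝ (Fin n)) : Prop where
  zero : x ∈ realZeros F
  isolated : ∃ ε : ℝ, 0 < ε ∧ ∀ z : Fin n → ℂ, (∀ j, ‖z j - (x j : ℂ)‖ < ε) →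
    (∀ i, MvPolynomial.aeval z (F i) = 0) → ∀ j, z j = (x j : ℂ)
  simple : (jacobianAt F x).det ≠ 0

/-- `p` is a point of `S` at minimal distance from `q`. -/
def IsNearestPoint {E : Type*} [Dist E] (S : Set E) (q p : E) : Prop :=
  p ∈ S ∧ ∀ p' ∈ S, dist q p ≤ dist q p'

/-- The point `(a, 0)` of `ℝⁿ⁺ᵏ`. -/
def zeroExtend {n : ℕ} (k : ℕ) (a : EuclideanSpace ℝ (Fin n)) :
    EuclideanSpace ℝ (Fin n ⊕ Fin k) :=
  WithLp.toLp 2 (Sum.elim (fun j => a j) (fun _ => 0))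

/-- The `x`-component of a point `(x, w)` of `ℝⁿ⁺ᵏ`. -/
def xPart {n k : ℕ} (p : EuclideanSpace ℝ (Fin n ⊕ Fin k)) : EuclideanSpace ℝ (Fin n) :=
  WithLp.toLp 2 (fun j => p (Sum.inl j))

/-- `S` is a smooth embedded submanifold of `E` of dimension `d`: around each of its points a
smooth local diffeomorphism of `E` straightens `S` to a linear subspace of dimension `d`. -/
def IsSmoothSubmanifold {E : Type*} [NormedAddCommGroup E] [NormedSpace ℝ E]
    (d : ℕ) (S : Set E) : Prop :=
  ∀ p ∈ S, ∃ (Φ : OpenPartialHomeomorph E E) (L : Submodule ℝ E),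
    p ∈ Φ.source ∧ ContDiffOn ℝ ∞ Φ Φ.source ∧ ContDiffOn ℝ ∞ Φ.symm Φ.target ∧
    Module.finrank ℝ L = d ∧ ∀ q ∈ Φ.source, q ∈ S ↔ Φ q ∈ L

/-- `γ` is continuous on `[s, t]` and of class `C^r` on each closed piece of a finite subdivision
of `[s, t]`. -/
def IsPiecewiseContDiffOn {E : Type*} [NormedAddCommGroup E] [NormedSpace ℝ E]
    (r : ℕ∞) (γ : ℝ → E) (s t : ℝ) : Prop :=
  ContinuousOn γ (Set.Icc s t) ∧
  ∃ (m : ℕ) (τ : Fin (m + 1) → ℝ), Monotone τ ∧ τ 0 = s ∧ τ (Fin.last m) = t ∧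
    ∀ i : Fin m, ContDiffOn ℝ r γ (Set.Icc (τ i.castSucc) (τ i.succ))

end CompanionCurve

end

/-!
The zero set of the slack system is the graph of `x ↦ -√β f(x)`, which a shear straightens to
`ℝⁿ × 0`. The squared distance from `(a, 0)` to the graph point over `x` is
`‖x - a‖² + β ‖f(x)‖²`, with gradient `2 (x + β J(x)ᵗ f(x) - a)`, so the nearest points are found
among the fibres of the penalty map `x ↦ x + β J(x)ᵗ f(x)`. At a zero `v` of `f` the derivative of
the penalty map is `1 + β JᵗJ`, which is positive definite, hence the penalty map is invertible
near `v`. Since the graph passes through `(v, 0)`, every nearest point to `(a, 0)` lies within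
`2 |a - v|` of `(v, 0)`; for `a` close to `v` it is therefore given by the local inverse of the
penalty map. This yields uniqueness, nonsingularity and the smooth dependence on `a`, and local
injectivity of the penalty map makes continuous lifts of a curve unique.
-/

namespace CompanionCurve

open Filter Topology RealInnerProductSpace
open scoped Matrix

section PolynomialCalculus

variable {R 𝕜 σ ι : Type*} [CommSemiring R] [NontriviallyNormedField 𝕜] [Algebra R 𝕜] [Fintype σ]

theorem hasStrictFDerivAt_aeval (p : MvPolynomial σ R) (z : σ → 𝕜) :
    HasStrictFDerivAt (fun x : σ → 𝕜 => MvPolynomial.aeval x p)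
      (∑ j, MvPolynomial.aeval z (MvPolynomial.pderiv j p) •
        ContinuousLinearMap.proj (R := 𝕜) (φ := fun _ : σ => 𝕜) j) z := by
  classical
  induction p using MvPolynomial.induction_on with
  | C a =>
    simp only [MvPolynomial.aeval_C]
    refine (hasStrictFDerivAt_const (algebraMap R 𝕜 a) z).congr_fderiv ?_
    ext v
    simp
  | add p q hp hq =>
    simp only [map_add]
    refine (hp.fun_add hq).congr_fderiv ?_
    ext v
    simp [add_mul, Finset.sum_add_distrib]
  | mul_X p i hp =>
    simp only [map_mul, MvPolynomial.aeval_X]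
    refine (hp.fun_mul (hasStrictFDerivAt_apply i z)).congr_fderiv ?_
    ext v
    simp [MvPolynomial.pderiv_X, Pi.single_apply, add_mul, Finset.sum_add_distrib, Finset.mul_sum,
      apply_ite, ite_mul, mul_assoc]

theorem hasStrictFDerivAt_pi_aeval [CompleteSpace 𝕜] [Finite ι] (F : ι → MvPolynomial σ R)
    (z : σ → 𝕜) :
    HasStrictFDerivAt (fun (x : σ → 𝕜) i => MvPolynomial.aeval x (F i))
      (LinearMap.toContinuousLinearMap (Matrix.of fun i j =>
        MvPolynomial.aeval z (MvPolynomial.pderiv j (F i))).mulVecLin) z := by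
  cases nonempty_fintype ι
  refine hasStrictFDerivAt_pi'.2 fun i => (hasStrictFDerivAt_aeval (F i) z).congr_fderiv ?_
  ext v
  simp [Matrix.mulVec, dotProduct]

theorem eventually_pi_aeval_ne [CompleteSpace 𝕜] [DecidableEq σ] (F : σ → MvPolynomial σ R)
    {z : σ → 𝕜}
    (hz : (Matrix.of fun i j => MvPolynomial.aeval z (MvPolynomial.pderiv j (F i))).det ≠ 0)
    (c : σ → 𝕜) :
    ∀ᶠ x in 𝓝[≠] z, (fun i => MvPolynomial.aeval x (F i)) ≠ c := by
  refine (hasStrictFDerivAt_pi_aeval F z).hasFDerivAt.eventually_ne ?_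
  obtain ⟨C, -, hC⟩ := LinearMap.exists_antilipschitzWith _ <|
    Matrix.ker_mulVecLin_eq_bot_iff.2 fun _ => Matrix.eq_zero_of_mulVec_eq_zero hz
  exact ⟨C, hC⟩

theorem isIsolatedSimpleZero_of_det_ne_zero {n : ℕ} {F : Fin n → MvPolynomial (Fin n) ℝ}
    {x : EuclideanSpace ℝ (Fin n)} (hx : x ∈ realZeros F) (hdet : (jacobianAt F x).det ≠ 0) :
    IsIsolatedSimpleZero F x := by
  have hdetℂ : (Matrix.of fun i j =>
      MvPolynomial.aeval (fun l => (x l : ℂ)) (MvPolynomial.pderiv j (F i))).det ≠ 0 := by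
    have hmap : (Matrix.of fun i j =>
        MvPolynomial.aeval (fun l => (x l : ℂ)) (MvPolynomial.pderiv j (F i))) =
          (algebraMap ℝ ℂ).mapMatrix (jacobianAt F x) := by
      ext i j
      exact MvPolynomial.aeval_algebraMap_apply ℂ (fun l => x l) _
    rw [hmap, ← RingHom.map_det]
    simpa using hdet
  obtain ⟨ε, hε, hball⟩ := Metric.eventually_nhds_iff.1
    (eventually_nhdsWithin_iff.1 (eventually_pi_aeval_ne F hdetℂ 0))
  refine ⟨hx, ⟨ε, hε, fun z hz h0 => ?_⟩, hdet⟩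
  have hdist : dist z (fun l => (x l : ℂ)) < ε :=
    (dist_pi_lt_iff hε).2 fun j => by simpa only [dist_eq_norm] using hz j
  by_contra hne
  exact hball hdist (fun h => hne (congrFun h)) (funext h0)

end PolynomialCalculus

section EvalMap

variable {σ ι : Type*}

/-- The polynomial map `x ↦ (F i (x))ᵢ` between Euclidean spaces given by a polynomial system. -/
noncomputable def evalMap (F : ι → MvPolynomial σ ℝ) (x : EuclideanSpace ℝ σ) :
    EuclideanSpace ℝ ι :=
  WithLp.toLp 2 fun i => MvPolynomial.eval (fun j => x j) (F i)

theorem mem_realZeros_iff_evalMap_eq_zero {F : ι → MvPolynomial σ ℝ} {x : EuclideanSpace ℝ σ} :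
    x ∈ realZeros F ↔ evalMap F x = 0 :=
  (PiLp.ext_iff (x := evalMap F x) (y := 0)).symm

theorem contDiff_eval [Fintype σ] {r : WithTop ℕ∞} (p : MvPolynomial σ ℝ) :
    ContDiff ℝ r fun x : EuclideanSpace ℝ σ => MvPolynomial.eval (fun j => x j) p :=
  (AnalyticOnNhd.eval_mvPolynomial p).contDiff.comp PiLp.contDiff_ofLp

variable [Fintype σ] [Fintype ι]

theorem contDiff_evalMap {r : WithTop ℕ∞} (F : ι → MvPolynomial σ ℝ) : ContDiff ℝ r (evalMap F) :=
  contDiff_euclidean.2 fun i => contDiff_eval (F i)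

variable [DecidableEq σ]

theorem hasStrictFDerivAt_evalMap (F : ι → MvPolynomial σ ℝ) (x : EuclideanSpace ℝ σ) :
    HasStrictFDerivAt (evalMap F)
      (LinearMap.toContinuousLinearMap (Matrix.toEuclideanLin (jacobianAt F x))) x :=
  ((PiLp.hasStrictFDerivAt_toLp 2 _).comp (x : σ → ℝ)
    (hasStrictFDerivAt_pi_aeval F (x : σ → ℝ))).comp x (PiLp.hasStrictFDerivAt_ofLp 2 x)

theorem exists_equiv_hasStrictFDerivAt_evalMap {F : σ → MvPolynomial σ ℝ} {x : EuclideanSpace ℝ σ}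
    (hdet : (jacobianAt F x).det ≠ 0) :
    ∃ e : EuclideanSpace ℝ σ ≃L[ℝ] EuclideanSpace ℝ σ,
      HasStrictFDerivAt (evalMap F) (e : EuclideanSpace ℝ σ →L[ℝ] EuclideanSpace ℝ σ) x := by
  have hD : (LinearMap.toContinuousLinearMap (Matrix.toEuclideanLin (jacobianAt F x))).det ≠ 0 := by
    simpa [ContinuousLinearMap.det] using hdet
  refine ⟨ContinuousLinearMap.toContinuousLinearEquivOfDetNeZero _ hD, ?_⟩
  simpa using hasStrictFDerivAt_evalMap F x

theorem continuous_det_jacobianAt (F : σ → MvPolynomial σ ℝ) :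
    Continuous fun x => (jacobianAt F x).det :=
  Continuous.matrix_det <| continuous_matrix fun _ _ => (contDiff_eval (r := 0) _).continuous

end EvalMap

section LiftsThroughLocallyInjectiveMaps

theorem eqOn_of_comp_eqOn_of_locally_injOn {A E F : Type*} [TopologicalSpace A]
    [TopologicalSpace E] [T2Space E] {G : E → F} {S : Set A} (hS : IsPreconnected S)
    {x y : A → E} (hx : ContinuousOn x S) (hy : ContinuousOn y S)
    (hG : S.EqOn (G ∘ y) (G ∘ x)) (hinj : ∀ u ∈ S, ∃ W ∈ 𝓝 (x u), W.InjOn G)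
    {u₀ : A} (hu₀ : u₀ ∈ S) (h₀ : y u₀ = x u₀) : S.EqOn y x := by
  have : PreconnectedSpace S := Subtype.preconnectedSpace hS
  rw [continuousOn_iff_continuous_domRestrict] at hx hy
  have hclosed : IsClosed {u : S | S.domRestrict y u = S.domRestrict x u} := isClosed_eq hy hx
  have hopen : IsOpen {u : S | S.domRestrict y u = S.domRestrict x u} := by
    refine isOpen_iff_mem_nhds.2 fun u (hu : y u = x u) => ?_
    obtain ⟨W, hW, hWinj⟩ := hinj u u.2
    filter_upwards [hx.continuousAt.eventually_mem hW,
      hy.continuousAt.eventually_mem (hu ▸ hW)] with w hxw hyw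
    exact hWinj hyw hxw (hG w.2)
  have huniv := IsClopen.eq_univ ⟨hclosed, hopen⟩ ⟨⟨u₀, hu₀⟩, h₀⟩
  exact fun u hu => Set.eq_univ_iff_forall.1 huniv ⟨u, hu⟩

theorem contDiffWithinAt_of_comp_of_injOn {𝕜 A E F : Type*} [RCLike 𝕜] [NormedAddCommGroup A]
    [NormedSpace 𝕜 A] [NormedAddCommGroup E] [NormedSpace 𝕜 E] [CompleteSpace E]
    [NormedAddCommGroup F] [NormedSpace 𝕜 F] {G : E → F} {e : E ≃L[𝕜] F} {W : Set E}
    {x : A → E} {S : Set A} {u : A} {m r : WithTop ℕ∞} (hr : r ≠ 0) (hmr : m ≤ r) (hu : u ∈ S)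
    (hG : ContDiffAt 𝕜 r G (x u)) (hG' : HasFDerivAt G (e : E →L[𝕜] F) (x u))
    (hW : IsOpen W) (hinj : W.InjOn G) (hxW : ∀ᶠ w in 𝓝[S] u, x w ∈ W)
    (hGx : ContDiffWithinAt 𝕜 m (G ∘ x) S u) : ContDiffWithinAt 𝕜 m x S u := by
  set X : F → E := hG.localInverse hG' hr
  have hX : ContDiffAt 𝕜 r X (G (x u)) := hG.to_localInverse hG' hr
  have hXu : X (G (x u)) = x u := hG.localInverse_apply_image hG' hr
  have hGX : ∀ᶠ y in 𝓝 (G (x u)), G (X y) = y :=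
    (hG.hasStrictFDerivAt' hG' hr).eventually_right_inverse
  have hXW : ∀ᶠ y in 𝓝 (G (x u)), X y ∈ W := hX.continuousAt.eventually_mem <|
    hW.mem_nhds (hXu.symm ▸ hxW.self_of_nhdsWithin hu)
  refine ((hX.of_le hmr).comp_contDiffWithinAt u hGx).congr_of_eventuallyEq_of_mem ?_ hu
  filter_upwards [hxW, hGx.continuousWithinAt.eventually (hGX.and hXW)] with w hxw hw
  exact hinj hxw hw.2 hw.1.symm

theorem IsPiecewiseContDiffOn.of_contDiffOn_imp {E F : Type*} [NormedAddCommGroup E]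
    [NormedSpace ℝ E] [NormedAddCommGroup F] [NormedSpace ℝ F] {r : ℕ∞} {γ : ℝ → E} {p : ℝ → F}
    {s t : ℝ} (hγ : IsPiecewiseContDiffOn r γ s t)
    (hp : ∀ (m : ℕ∞), ∀ S ⊆ Set.Icc s t, ContDiffOn ℝ m γ S → ContDiffOn ℝ m p S) :
    IsPiecewiseContDiffOn r p s t := by
  obtain ⟨hcont, m, τ, hτ, hτ₀, hτm, hpieces⟩ := hγ
  refine ⟨contDiffOn_zero.1 (hp 0 _ subset_rfl (contDiffOn_zero.2 hcont)), m, τ, hτ, hτ₀, hτm,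
    fun i => hp r _ ?_ (hpieces i)⟩
  exact Set.Icc_subset_Icc (hτ₀ ▸ hτ (Fin.zero_le _)) (hτm ▸ hτ (Fin.le_last _))

end LiftsThroughLocallyInjectiveMaps

section NearestPoint

variable {E : Type*} [PseudoMetricSpace E] {S : Set E}

theorem exists_isNearestPoint [ProperSpace E] (hS : IsClosed S) (hne : S.Nonempty) (q : E) :
    ∃ p, IsNearestPoint S q p := by
  obtain ⟨p, hp, h⟩ := hS.exists_infDist_eq_dist hne q
  exact ⟨p, hp, fun p' hp' => h ▸ Metric.infDist_le_dist_of_mem hp'⟩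

theorem IsNearestPoint.dist_le_two_mul {p q v : E} (hp : IsNearestPoint S q p) (hv : v ∈ S) :
    dist p v ≤ 2 * dist q v := by
  linarith [dist_triangle_left p v q, hp.2 v hv]

end NearestPoint

theorem isSmoothSubmanifold_preimage {E : Type*} [NormedAddCommGroup E] [NormedSpace ℝ E]
    {Φ Ψ : E → E} (hΦ : ContDiff ℝ ∞ Φ) (hΨ : ContDiff ℝ ∞ Ψ) (hl : Function.LeftInverse Ψ Φ)
    (hr : Function.RightInverse Ψ Φ) (L : Submodule ℝ E) :
    IsSmoothSubmanifold (Module.finrank ℝ L) (Φ ⁻¹' L) := fun _ _ =>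
  ⟨(Homeomorph.mk ⟨Φ, Ψ, hl, hr⟩ hΦ.continuous hΨ.continuous).toOpenPartialHomeomorph, L, trivial,
    hΦ.contDiffOn, hΨ.contDiffOn, rfl, fun _ _ => Iff.rfl⟩

variable {n k : ℕ}

section Graph

variable {g : EuclideanSpace ℝ (Fin n) → EuclideanSpace ℝ (Fin k)}

/-- The parametrisation `x ↦ (x, g x)` of the graph of `g`, with the two blocks of coordinates
joined into one Euclidean space. -/
noncomputable def graphPoint (g : EuclideanSpace ℝ (Fin n) → EuclideanSpace ℝ (Fin k))
    (x : EuclideanSpace ℝ (Fin n)) : EuclideanSpace ℝ (Fin n ⊕ Fin k) :=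
  WithLp.toLp 2 (Sum.elim (fun j => x j) fun i => g x i)

@[simp]
theorem xPart_graphPoint (x : EuclideanSpace ℝ (Fin n)) : xPart (graphPoint g x) = x := rfl

theorem mem_range_graphPoint_iff {p : EuclideanSpace ℝ (Fin n ⊕ Fin k)} :
    p ∈ Set.range (graphPoint g) ↔ ∀ i, p (Sum.inr i) = g (xPart p) i := by
  refine ⟨?_, fun h => ⟨xPart p, ?_⟩⟩
  · rintro ⟨x, rfl⟩ i
    rfl
  · ext (j | i)
    exacts [rfl, (h i).symm]

theorem contDiff_xPart {r : WithTop ℕ∞} :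
    ContDiff ℝ r (xPart : EuclideanSpace ℝ (Fin n ⊕ Fin k) → EuclideanSpace ℝ (Fin n)) :=
  contDiff_euclidean.2 fun j => contDiff_piLp_apply 2 (i := Sum.inl j)

theorem contDiff_graphPoint {r : WithTop ℕ∞} (hg : ContDiff ℝ r g) :
    ContDiff ℝ r (graphPoint g) := by
  refine contDiff_euclidean.2 ?_
  rintro (j | i)
  exacts [contDiff_piLp_apply 2 (i := j), contDiff_euclidean.1 hg i]

theorem isClosed_range_graphPoint (hg : Continuous g) : IsClosed (Set.range (graphPoint g)) :=
  Function.LeftInverse.isClosed_range xPart_graphPoint (contDiff_xPart (r := 0)).continuous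
    (contDiff_graphPoint (contDiff_zero.2 hg)).continuous

theorem dist_xPart_le (p q : EuclideanSpace ℝ (Fin n ⊕ Fin k)) :
    dist (xPart p) (xPart q) ≤ dist p q := by
  simp only [EuclideanSpace.dist_eq, Fintype.sum_sum_type]
  exact Real.sqrt_le_sqrt (le_add_of_nonneg_right (by positivity))

theorem dist_sq_zeroExtend_graphPoint (a x : EuclideanSpace ℝ (Fin n)) :
    dist (zeroExtend k a) (graphPoint g x) ^ 2 = ‖x - a‖ ^ 2 + ‖g x‖ ^ 2 := by
  rw [← dist_eq_norm, dist_comm x a]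
  simp [EuclideanSpace.dist_sq_eq, EuclideanSpace.norm_sq_eq, zeroExtend, graphPoint, Real.dist_eq]

/-- The shear `(x, w) ↦ (x, w + g x)`, a diffeomorphism carrying the graph of `-g` to `ℝⁿ × 0`. -/
noncomputable def shear (g : EuclideanSpace ℝ (Fin n) → EuclideanSpace ℝ (Fin k))
    (p : EuclideanSpace ℝ (Fin n ⊕ Fin k)) : EuclideanSpace ℝ (Fin n ⊕ Fin k) :=
  WithLp.toLp 2 (Sum.elim (fun j => p (Sum.inl j)) fun i => p (Sum.inr i) + g (xPart p) i)

theorem contDiff_shear {r : WithTop ℕ∞} (hg : ContDiff ℝ r g) : ContDiff ℝ r (shear g) := by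
  refine contDiff_euclidean.2 ?_
  rintro (j | i)
  exacts [contDiff_piLp_apply 2 (i := Sum.inl j),
    (contDiff_piLp_apply 2 (i := Sum.inr i)).add (contDiff_euclidean.1 (hg.comp contDiff_xPart) i)]

theorem leftInverse_shear_neg : Function.LeftInverse (shear (-g)) (shear g) := by
  intro p
  ext (j | i)
  exacts [rfl, add_neg_cancel_right _ _]

/-- The linear inclusion `x ↦ (x, 0)`. Its range `ℝⁿ × 0` is the subspace to which `shear (-g)`
straightens the graph of `g`. -/
noncomputable def zeroExtendLinear (n k : ℕ) :
    EuclideanSpace ℝ (Fin n) →ₗ[ℝ] EuclideanSpace ℝ (Fin n ⊕ Fin k) where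
  toFun := zeroExtend k
  map_add' x y := by ext (j | i) <;> simp [zeroExtend]
  map_smul' c x := by ext (j | i) <;> simp [zeroExtend]

theorem zeroExtendLinear_injective : Function.Injective (zeroExtendLinear n k) :=
  Function.LeftInverse.injective (g := xPart) fun _ => rfl

theorem mem_range_zeroExtendLinear {p : EuclideanSpace ℝ (Fin n ⊕ Fin k)} :
    p ∈ LinearMap.range (zeroExtendLinear n k) ↔ ∀ i, p (Sum.inr i) = 0 :=
  mem_range_graphPoint_iff (g := 0)

theorem isSmoothSubmanifold_range_graphPoint (hg : ContDiff ℝ ∞ g) :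
    IsSmoothSubmanifold n (Set.range (graphPoint g)) := by
  have hrange : Set.range (graphPoint g) =
      shear (-g) ⁻¹' (LinearMap.range (zeroExtendLinear n k)) := by
    ext p
    rw [mem_range_graphPoint_iff, Set.mem_preimage, SetLike.mem_coe, mem_range_zeroExtendLinear]
    exact forall_congr' fun i => (sub_eq_add_neg (p (Sum.inr i)) _ ▸ sub_eq_zero).symm
  have hdim : Module.finrank ℝ (LinearMap.range (zeroExtendLinear n k)) = n := by
    rw [LinearMap.finrank_range_of_inj zeroExtendLinear_injective, finrank_euclideanSpace_fin]
  have hneg : ContDiff ℝ ∞ (-g) := hg.neg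
  have hsub := isSmoothSubmanifold_preimage (contDiff_shear hneg) (contDiff_shear hg)
    (by simpa only [neg_neg] using leftInverse_shear_neg (g := -g)) leftInverse_shear_neg
    (LinearMap.range (zeroExtendLinear n k))
  rwa [hdim, ← hrange] at hsub

theorem IsNearestPoint.eq_graphPoint_xPart {p q : EuclideanSpace ℝ (Fin n ⊕ Fin k)}
    (hp : IsNearestPoint (Set.range (graphPoint g)) q p) : p = graphPoint g (xPart p) := by
  obtain ⟨⟨x, rfl⟩, -⟩ := hp
  rfl

theorem IsNearestPoint.dist_xPart_le_two_mul {p : EuclideanSpace ℝ (Fin n ⊕ Fin k)}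
    {a v : EuclideanSpace ℝ (Fin n)}
    (hp : IsNearestPoint (Set.range (graphPoint g)) (zeroExtend k a) p) (hv : g v = 0) :
    dist (xPart p) v ≤ 2 * dist a v := by
  have hav : dist (zeroExtend k a) (graphPoint g v) = dist a v := by
    rw [← sq_eq_sq₀ dist_nonneg dist_nonneg, dist_sq_zeroExtend_graphPoint, hv, dist_comm a v,
      dist_eq_norm]
    simp
  exact (dist_xPart_le p (graphPoint g v)).trans (hav ▸ hp.dist_le_two_mul ⟨v, rfl⟩)

-- The first-order condition: `xPart p` minimises `‖x - a‖ ^ 2 + ‖g x‖ ^ 2`.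
theorem IsNearestPoint.inner_add_inner_eq_zero {p : EuclideanSpace ℝ (Fin n ⊕ Fin k)}
    {a : EuclideanSpace ℝ (Fin n)} {g' : EuclideanSpace ℝ (Fin n) →L[ℝ] EuclideanSpace ℝ (Fin k)}
    (hp : IsNearestPoint (Set.range (graphPoint g)) (zeroExtend k a) p)
    (hg : HasFDerivAt g g' (xPart p)) (v : EuclideanSpace ℝ (Fin n)) :
    ⟪xPart p - a, v⟫ + ⟪g (xPart p), g' v⟫ = 0 := by
  have hmin : IsLocalMin (fun x => ‖x - a‖ ^ 2 + ‖g x‖ ^ 2) (xPart p) := .of_forall fun x => by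
    simp only [← dist_sq_zeroExtend_graphPoint, ← hp.eq_graphPoint_xPart]
    gcongr
    exact hp.2 _ ⟨x, rfl⟩
  have hderiv := ((hasFDerivAt_id (xPart p)).sub_const a).norm_sq.add hg.norm_sq
  have hzero := DFunLike.congr_fun (hmin.hasFDerivAt_eq_zero hderiv) v
  simp only [id_eq, add_apply, smul_apply, ContinuousLinearMap.comp_apply,
    ContinuousLinearMap.id_apply, innerSL_apply_apply, nsmul_eq_mul, zero_apply] at hzero
  push_cast at hzero
  linarith

end Graph

section Penalty

variable {f : Fin k → MvPolynomial (Fin n) ℝ} {β : ℝ}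

/-- The map `x ↦ -√β f(x)`, whose graph is the zero set of the slack system. -/
noncomputable def slackMap (f : Fin k → MvPolynomial (Fin n) ℝ) (β : ℝ)
    (x : EuclideanSpace ℝ (Fin n)) : EuclideanSpace ℝ (Fin k) :=
  -√β • evalMap f x

theorem contDiff_slackMap {r : WithTop ℕ∞} : ContDiff ℝ r (slackMap f β) :=
  (contDiff_evalMap f).const_smul (-√β)

theorem realZeros_slackSystem (f : Fin k → MvPolynomial (Fin n) ℝ) (hβ : 0 < β) :
    realZeros (slackSystem f β) = Set.range (graphPoint (slackMap f β)) := by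
  have hsqrt : √β ≠ 0 := (Real.sqrt_pos.2 hβ).ne'
  ext p
  rw [mem_range_graphPoint_iff]
  refine forall_congr' fun i => ?_
  simp only [slackSystem, slackMap, evalMap, xPart, map_add, map_mul, MvPolynomial.eval_rename,
    MvPolynomial.eval_C, MvPolynomial.eval_X, Function.comp_def, PiLp.smul_apply, smul_eq_mul]
  field_simp
  constructor <;> intro h <;> linarith

/-- The map `x ↦ x + β J(x)ᵗ f(x)`, encoded as the evaluation of the penalty system with constant
term `0`; the solutions of the square system are its fibres. -/
noncomputable def penaltyMap (f : Fin k → MvPolynomial (Fin n) ℝ) (β : ℝ) :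
    EuclideanSpace ℝ (Fin n) → EuclideanSpace ℝ (Fin n) :=
  evalMap (penaltySystem f β 0)

theorem penaltyMap_apply (x : EuclideanSpace ℝ (Fin n)) (j : Fin n) :
    penaltyMap f β x j = x j + β * ∑ i, jacobianAt f x i j * evalMap f x i := by
  simp [penaltyMap, evalMap, penaltySystem, jacobianAt]

theorem mem_realZeros_penaltySystem_iff {a x : EuclideanSpace ℝ (Fin n)} :
    x ∈ realZeros (penaltySystem f β a) ↔ penaltyMap f β x = a := by
  rw [PiLp.ext_iff]
  refine forall_congr' fun j => ?_
  simp [penaltyMap, evalMap, penaltySystem, sub_eq_zero]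

theorem jacobianAt_penaltySystem (a x : EuclideanSpace ℝ (Fin n)) :
    jacobianAt (penaltySystem f β a) x = jacobianAt (penaltySystem f β 0) x := by
  ext i j
  simp [jacobianAt, penaltySystem]

theorem jacobianAt_penaltySystem_of_mem_realZeros {a v : EuclideanSpace ℝ (Fin n)}
    (hv : v ∈ realZeros f) :
    jacobianAt (penaltySystem f β a) v = 1 + β • ((jacobianAt f v)ᴴ * jacobianAt f v) := by
  ext j l
  have hz : ∀ i, MvPolynomial.eval (fun j => v j) (f i) = 0 := hv
  simp [jacobianAt, penaltySystem, Matrix.mul_apply, MvPolynomial.pderiv_X, Matrix.one_apply,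
    Pi.single_apply, hz, apply_ite]

theorem det_jacobianAt_penaltySystem_pos (hβ : 0 ≤ β) {a v : EuclideanSpace ℝ (Fin n)}
    (hv : v ∈ realZeros f) : 0 < (jacobianAt (penaltySystem f β a) v).det := by
  rw [jacobianAt_penaltySystem_of_mem_realZeros hv]
  exact (Matrix.PosDef.one.add_posSemidef
    ((Matrix.posSemidef_conjTranspose_mul_self _).smul hβ)).det_pos

theorem IsNearestPoint.penaltyMap_xPart {a : EuclideanSpace ℝ (Fin n)}
    {p : EuclideanSpace ℝ (Fin n ⊕ Fin k)} (hβ : 0 ≤ β)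
    (hp : IsNearestPoint (Set.range (graphPoint (slackMap f β))) (zeroExtend k a) p) :
    penaltyMap f β (xPart p) = a := by
  have hslack : HasFDerivAt (slackMap f β) _ (xPart p) :=
    (hasStrictFDerivAt_evalMap f (xPart p)).hasFDerivAt.const_smul (-√β)
  ext j
  have h := hp.inner_add_inner_eq_zero hslack (EuclideanSpace.single j 1)
  have hgrad : xPart p j - a j +
      ∑ i, √β * jacobianAt f (xPart p) i j * (√β * evalMap f (xPart p) i) = 0 := by
    simpa [PiLp.inner_apply, slackMap] using h
  have hsum : ∑ i, √β * jacobianAt f (xPart p) i j * (√β * evalMap f (xPart p) i) =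
      β * ∑ i, jacobianAt f (xPart p) i j * evalMap f (xPart p) i := by
    rw [Finset.mul_sum]
    refine Finset.sum_congr rfl fun i _ => ?_
    linear_combination jacobianAt f (xPart p) i j * evalMap f (xPart p) i * Real.mul_self_sqrt hβ
  rw [penaltyMap_apply]
  linarith

end Penalty

section RegularNeighbourhood

variable {f : Fin k → MvPolynomial (Fin n) ℝ} {β : ℝ}

/-- The points `a` such that, for all `b` near `a`, the nearest points of the slack graph to
`(b, 0)` lie over one open set on which the penalty map is injective with nonsingular Jacobian.
It is the neighbourhood `U'` of the zero set of `f`; asking for the condition at all `b` near `a`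
makes it open by construction. -/
def regularNhd (f : Fin k → MvPolynomial (Fin n) ℝ) (β : ℝ) : Set (EuclideanSpace ℝ (Fin n)) :=
  {a | ∃ W, IsOpen W ∧ W.InjOn (penaltyMap f β) ∧
    (∀ x ∈ W, (jacobianAt (penaltySystem f β 0) x).det ≠ 0) ∧
    ∀ᶠ b in 𝓝 a, ∀ p,
      IsNearestPoint (Set.range (graphPoint (slackMap f β))) (zeroExtend k b) p → xPart p ∈ W}

theorem isOpen_regularNhd : IsOpen (regularNhd f β) := by
  refine isOpen_iff_mem_nhds.2 ?_
  rintro a ⟨W, hW, hinj, hdet, hnear⟩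
  filter_upwards [hnear.eventually_nhds] with b hb
  exact ⟨W, hW, hinj, hdet, hb⟩

theorem realZeros_subset_regularNhd (hβ : 0 ≤ β) : realZeros f ⊆ regularNhd f β := by
  intro v hv
  have hdet : (jacobianAt (penaltySystem f β 0) v).det ≠ 0 :=
    (det_jacobianAt_penaltySystem_pos hβ hv).ne'
  obtain ⟨e, he⟩ := exists_equiv_hasStrictFDerivAt_evalMap hdet
  obtain ⟨δ, hδ, hball⟩ := Metric.eventually_nhds_iff_ball.1 <| he.eventually_left_inverse.and <|
    (continuous_det_jacobianAt (penaltySystem f β 0)).continuousAt.eventually_ne hdet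
  refine ⟨Metric.ball v δ, Metric.isOpen_ball,
    Set.LeftInvOn.injOn (f₁' := he.localInverse) fun x hx => (hball x hx).1,
    fun x hx => (hball x hx).2, ?_⟩
  filter_upwards [Metric.ball_mem_nhds v (half_pos hδ)] with b hb p hp
  have hslack : slackMap f β v = 0 := by
    rw [slackMap, mem_realZeros_iff_evalMap_eq_zero.1 hv, smul_zero]
  rw [Metric.mem_ball] at hb ⊢
  linarith [hp.dist_xPart_le_two_mul hslack]

variable {a : EuclideanSpace ℝ (Fin n)}

theorem existsUnique_isNearestPoint (hβ : 0 ≤ β) (ha : a ∈ regularNhd f β) :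
    ∃! p, IsNearestPoint (Set.range (graphPoint (slackMap f β))) (zeroExtend k a) p := by
  obtain ⟨W, -, hinj, -, hnear⟩ := ha
  have hW := hnear.self_of_nhds
  refine existsUnique_of_exists_of_unique (exists_isNearestPoint
    (isClosed_range_graphPoint (contDiff_slackMap (r := 0)).continuous) (Set.range_nonempty _) _)
    fun p q hp hq => ?_
  have hx : xPart p = xPart q := hinj (hW p hp) (hW q hq) <|
    (hp.penaltyMap_xPart hβ).trans (hq.penaltyMap_xPart hβ).symm
  rw [hp.eq_graphPoint_xPart, hq.eq_graphPoint_xPart, hx]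

theorem IsNearestPoint.isIsolatedSimpleZero_xPart {p : EuclideanSpace ℝ (Fin n ⊕ Fin k)}
    (hβ : 0 ≤ β) (ha : a ∈ regularNhd f β)
    (hp : IsNearestPoint (Set.range (graphPoint (slackMap f β))) (zeroExtend k a) p) :
    IsIsolatedSimpleZero (penaltySystem f β a) (xPart p) := by
  obtain ⟨W, -, -, hdet, hnear⟩ := ha
  refine isIsolatedSimpleZero_of_det_ne_zero
    (mem_realZeros_penaltySystem_iff.2 (hp.penaltyMap_xPart hβ)) ?_
  rw [jacobianAt_penaltySystem]
  exact hdet _ (hnear.self_of_nhds p hp)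

section Curve

variable {A : Type*} {γ : A → EuclideanSpace ℝ (Fin n)}
  {p : A → EuclideanSpace ℝ (Fin n ⊕ Fin k)} {S : Set A}

theorem contDiffOn_nearestPoint [NormedAddCommGroup A] [NormedSpace ℝ A] {m : WithTop ℕ∞}
    (hβ : 0 ≤ β) (hγ : ContDiffOn ℝ m γ S) (hγU : S.MapsTo γ (regularNhd f β))
    (hp : ∀ u ∈ S, IsNearestPoint (Set.range (graphPoint (slackMap f β)))
      (zeroExtend k (γ u)) (p u)) :
    ContDiffOn ℝ m p S := by
  have hsolves : S.EqOn (penaltyMap f β ∘ (xPart ∘ p)) γ := fun u hu =>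
    (hp u hu).penaltyMap_xPart hβ
  have hx : ContDiffOn ℝ m (xPart ∘ p) S := fun u hu => by
    obtain ⟨W, hW, hinj, hdet, hnear⟩ := hγU hu
    obtain ⟨e, he⟩ := exists_equiv_hasStrictFDerivAt_evalMap
      (hdet _ (hnear.self_of_nhds _ (hp u hu)))
    have hxW : ∀ᶠ w in 𝓝[S] u, xPart (p w) ∈ W := by
      filter_upwards [(hγ u hu).continuousWithinAt.eventually hnear, self_mem_nhdsWithin]
        with w hw hwS
      exact hw _ (hp w hwS)
    exact contDiffWithinAt_of_comp_of_injOn (by simp) le_top hu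
      (contDiff_evalMap (r := ⊤) (penaltySystem f β 0)).contDiffAt he.hasFDerivAt hW hinj hxW
      ((hγ u hu).congr_of_mem hsolves hu)
  exact ((contDiff_graphPoint contDiff_slackMap).comp_contDiffOn hx).congr fun u hu =>
    (hp u hu).eq_graphPoint_xPart

theorem eqOn_xPart_nearestPoint [TopologicalSpace A] {y : A → EuclideanSpace ℝ (Fin n)} {u₀ : A}
    (hβ : 0 ≤ β) (hS : IsPreconnected S) (hpc : ContinuousOn p S)
    (hγU : S.MapsTo γ (regularNhd f β))
    (hp : ∀ u ∈ S, IsNearestPoint (Set.range (graphPoint (slackMap f β)))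
      (zeroExtend k (γ u)) (p u))
    (hy : ContinuousOn y S) (hsolves : ∀ u ∈ S, y u ∈ realZeros (penaltySystem f β (γ u)))
    (hu₀ : u₀ ∈ S) (h₀ : y u₀ = xPart (p u₀)) : S.EqOn y (xPart ∘ p) := by
  refine eqOn_of_comp_eqOn_of_locally_injOn (G := penaltyMap f β) hS
    ((contDiff_xPart (r := 0)).continuous.comp_continuousOn hpc) hy (fun u hu => ?_)
    (fun u hu => ?_) hu₀ h₀
  · exact (mem_realZeros_penaltySystem_iff.1 (hsolves u hu)).trans
      ((hp u hu).penaltyMap_xPart hβ).symm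
  · obtain ⟨W, hW, hinj, -, hnear⟩ := hγU hu
    exact ⟨W, hW.mem_nhds (hnear.self_of_nhds _ (hp u hu)), hinj⟩

end Curve

end RegularNeighbourhood

end CompanionCurve

theorem mainTheorem1 (n k : ℕ) (f : Fin k → MvPolynomial (Fin n) ℝ)
    (hf : (CompanionCurve.realZeros f).Nonempty) (β : ℝ) (hβ : 0 < β) :
    CompanionCurve.IsSmoothSubmanifold n
      (CompanionCurve.realZeros (CompanionCurve.slackSystem f β)) ∧
    ∃ U : Set (EuclideanSpace ℝ (Fin n)),
      IsOpen U ∧ CompanionCurve.realZeros f ⊆ U ∧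
      -- every `(a, 0)` with `a ∈ U` has a unique nearest point on `V_ℝ(h)`,
      (∀ a ∈ U, ∃! p, CompanionCurve.IsNearestPoint
        (CompanionCurve.realZeros (CompanionCurve.slackSystem f β))
        (CompanionCurve.zeroExtend k a) p) ∧
      -- whose `x`-component is an isolated simple zero of `x + β Jᵗ f = a`;
      (∀ a ∈ U, ∀ p, CompanionCurve.IsNearestPoint
        (CompanionCurve.realZeros (CompanionCurve.slackSystem f β))
        (CompanionCurve.zeroExtend k a) p →
        CompanionCurve.IsIsolatedSimpleZero (CompanionCurve.penaltySystem f β a)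
          (CompanionCurve.xPart p)) ∧
      -- along a piecewise smooth curve in `U` the projection trajectory is piecewise smooth, and
      -- it is the only continuous solution of the equation from any of its points.
      (∀ (r : ℕ∞) (s t : ℝ) (γ : ℝ → EuclideanSpace ℝ (Fin n)), 1 ≤ r → s ≤ t →
        CompanionCurve.IsPiecewiseContDiffOn r γ s t → (∀ u ∈ Set.Icc s t, γ u ∈ U) →
        ∀ p : ℝ → EuclideanSpace ℝ (Fin n ⊕ Fin k),
          (∀ u ∈ Set.Icc s t, CompanionCurve.IsNearestPoint
            (CompanionCurve.realZeros (CompanionCurve.slackSystem f β))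
            (CompanionCurve.zeroExtend k (γ u)) (p u)) →
          CompanionCurve.IsPiecewiseContDiffOn r p s t ∧
          ∀ u₀ ∈ Set.Icc s t, ∀ y : ℝ → EuclideanSpace ℝ (Fin n),
            ContinuousOn y (Set.Icc s t) →
            (∀ u ∈ Set.Icc s t,
              y u ∈ CompanionCurve.realZeros (CompanionCurve.penaltySystem f β (γ u))) →
            y u₀ = CompanionCurve.xPart (p u₀) →
            ∀ u ∈ Set.Icc s t, y u = CompanionCurve.xPart (p u)) := by
  open CompanionCurve in
  rw [realZeros_slackSystem f hβ]
  refine ⟨isSmoothSubmanifold_range_graphPoint contDiff_slackMap, regularNhd f β,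
    isOpen_regularNhd, realZeros_subset_regularNhd hβ.le,
    fun a ha => existsUnique_isNearestPoint hβ.le ha,
    fun a ha p hp => hp.isIsolatedSimpleZero_xPart hβ.le ha, ?_⟩
  intro r s t γ _ _ hγ hγU p hp
  have hpiecewise : IsPiecewiseContDiffOn r p s t := hγ.of_contDiffOn_imp fun m S hS hγS =>
    contDiffOn_nearestPoint hβ.le hγS (fun u hu => hγU u (hS hu)) fun u hu => hp u (hS hu)
  exact ⟨hpiecewise, fun u₀ hu₀ y hy hsolves h₀ =>
    eqOn_xPart_nearestPoint hβ.le isPreconnected_Icc hpiecewise.1 hγU hp hy hsolves hu₀ h₀⟩
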